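/- Let $m\ge 1$ be an integer, let $p>m(m+1)$ be real and set $\alpha=1-\frac{m(m+1)}{p}\in(0,1)$. For an integer $N\ge 2$ let $f_0:\mathbb R\to\mathbb R$ be the $1$-periodic function with $f_0(t)=2t$ for $0\le t\le \frac12$ and $f_0(t)=2-2t$ for $\frac12<t\le 1$, and set $$f(x)=\sum_{k=0}^{\infty}\frac{f_0(N^kx)}{N^{\alpha k}},\qquad F(x)=\int_0^x f(t)\,dt,\qquad G:\mathbb R^m\to\mathbb R^{m+1},\quad G(x^1,\dots,x^m)=(x^1,\dots,x^m,F(x^1)).$$ For an $m$-dimensional set $\Sigma\subseteq\mathbb R^n$ define the $p$-energy $$\mathcal E_p(\Sigma)=\int_{\Sigma^{m+2}}\left(\frac{\mathcal H^{m+1}(\operatorname{conv}\{x_0,\dots,x_{m+1}\})}{\operatorname{diam}(\{x_0,\dots,x_{m+1}\})^{m+2}}\right)^{p}\,d\mathcal H^m_{x_0}\cdots d\mathcal H^m_{x_{m+1}},$$ where $\mathcal H^k$ is the $k$-dimensional Hausdorff measure and the integrand is $0$ when all the points coincide. Then there is $N_0=N_0(m,p)$ such that for every integer $N\ge N_0$: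 the function $F$ is of class $C^{1,\alpha}$ on $\mathbb R$ (it is $C^1$ and $F'$ is $\alpha$-Hölder continuous); the set $\Sigma=G([0,1]^m)\subseteq\mathbb R^{m+1}$ is a compact embedded $m$-dimensional manifold (with boundary and corners) of class $C^{1,\alpha}$; and $\mathcal E_p(\Sigma)=\infty$. Moreover $G((0,1)^m)$ is an embedded $m$-dimensional manifold without boundary of class $C^{1,\alpha}$, and $\mathcal E_p(G((0,1)^m))=\infty$. In particular, there is a manifold $\Sigma$ of class $C^{1,\alpha}$ of dimension $m$ with $\mathcal E_p(\Sigma)=\infty$. -/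

import Mathlib

open MeasureTheory
open scoped ENNReal

noncomputable section

/-- `φ` is of class `C^{1,α}` on the open set `W`: it is continuously differentiable on `W` and its
derivative is Hölder continuous on `W` with exponent `α`. -/
def IsC1Holder {E F : Type*} [NormedAddCommGroup E] [NormedSpace ℝ E]
    [NormedAddCommGroup F] [NormedSpace ℝ F] (α : ℝ) (φ : E → F) (W : Set E) : Prop :=
  ContDiffOn ℝ 1 φ W ∧
    ∃ C : ℝ, ∀ x ∈ W, ∀ y ∈ W, ‖fderiv ℝ φ x - fderiv ℝ φ y‖ ≤ C * ‖x - y‖ ^ α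

/-- The closed corner `{x ∈ ℝ^m : x^i ≥ 0 for i ∈ s}`. For `s = ∅` it is all of `ℝ^m`, for `s` a
singleton it is a half space. -/
def cornerModel (m : ℕ) (s : Finset (Fin m)) : Set (EuclideanSpace ℝ (Fin m)) :=
  {x | ∀ i ∈ s, 0 ≤ x i}

/-- Near the point `a`, the set `S ⊆ ℝ^n` is `C^{1,α}` parametrized by a relatively open subset of
the corner of `ℝ^m` given by `s`: there are an open neighbourhood `U` of `a`, an open `W ⊆ ℝ^m` and
a `C^{1,α}` immersion `φ` of `W` that restricts to a homeomorphism (with inverse `ψ`) of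
`W ∩ cornerModel m s` onto `S ∩ U`. -/
def HasC1HolderChartAt {n : ℕ} (m : ℕ) (α : ℝ) (s : Finset (Fin m))
    (S : Set (EuclideanSpace ℝ (Fin n))) (a : EuclideanSpace ℝ (Fin n)) : Prop :=
  ∃ (U : Set (EuclideanSpace ℝ (Fin n))) (W : Set (EuclideanSpace ℝ (Fin m)))
    (φ : EuclideanSpace ℝ (Fin m) → EuclideanSpace ℝ (Fin n))
    (ψ : EuclideanSpace ℝ (Fin n) → EuclideanSpace ℝ (Fin m)),
    IsOpen U ∧ a ∈ U ∧ IsOpen W ∧ IsC1Holder α φ W ∧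
    (∀ x ∈ W, Function.Injective (fderiv ℝ φ x)) ∧
    φ '' (W ∩ cornerModel m s) = S ∩ U ∧
    ContinuousOn ψ (S ∩ U) ∧
    ∀ x ∈ W ∩ cornerModel m s, ψ (φ x) = x

/-- `S` is an embedded `m`-dimensional manifold of class `C^{1,α}` in `ℝ^n`, without boundary. -/
def IsC1HolderManifold {n : ℕ} (m : ℕ) (α : ℝ) (S : Set (EuclideanSpace ℝ (Fin n))) : Prop :=
  ∀ a ∈ S, HasC1HolderChartAt m α ∅ S a

/-- `S` is an embedded `m`-dimensional manifold of class `C^{1,α}` in `ℝ^n`, possibly with boundary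
and corners. -/
def IsC1HolderManifoldWithCorners {n : ℕ} (m : ℕ) (α : ℝ)
    (S : Set (EuclideanSpace ℝ (Fin n))) : Prop :=
  ∀ a ∈ S, ∃ s : Finset (Fin m), HasC1HolderChartAt m α s S a

/-- The discrete curvature `𝓗^{m+1}(conv T) / diam(T)^{m+2}` of an `(m+2)`-tuple `T` of points of
`ℝ^n`, where `𝓗^{m+1}` is the Hausdorff measure normalized to agree with Lebesgue measure on
`ℝ^{m+1}`. It is `0` if all points of `T` coincide. -/
def discreteCurvature {n : ℕ} (m : ℕ) (T : Fin (m + 2) → EuclideanSpace ℝ (Fin n)) : ℝ≥0∞ :=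
  μHE[m + 1] (convexHull ℝ (Set.range T)) / Metric.ediam (Set.range T) ^ (m + 2)

/-- The `p`-energy of an `m`-dimensional set `S ⊆ ℝ^n`: the integral of the `p`-th power of the
discrete curvature over `S^{m+2}` with respect to the `(m+2)`-fold product of the
`m`-dimensional Hausdorff measure on `S`. -/
def pEnergy {n : ℕ} (m : ℕ) (p : ℝ) (S : Set (EuclideanSpace ℝ (Fin n))) : ℝ≥0∞ :=
  ∫⁻ T : Fin (m + 2) → EuclideanSpace ℝ (Fin n), discreteCurvature m T ^ p
    ∂(Measure.pi fun _ => (μHE[m] : Measure (EuclideanSpace ℝ (Fin n))).restrict S)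

/-- One tooth of the saw: `2t` on `[0, 1/2]` and `2 - 2t` on `(1/2, 1]`. -/
def tooth (t : ℝ) : ℝ := if t ≤ 1 / 2 then 2 * t else 2 - 2 * t

/-- The `1`-periodic saw `f₀(x) = tooth (x - ⌊x⌋)`. -/
def saw (x : ℝ) : ℝ := tooth (Int.fract x)

/-- The van der Waerden type function `f(x) = ∑_{k ≥ 0} N^{-αk} f₀(N^k x)`. -/
def waerden (N : ℕ) (α : ℝ) (x : ℝ) : ℝ :=
  ∑' k : ℕ, saw ((N : ℝ) ^ k * x) / (N : ℝ) ^ (α * (k : ℝ))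

/-- The primitive `F(x) = ∫_0^x f(t) dt`. -/
def waerdenPrimitive (N : ℕ) (α : ℝ) (x : ℝ) : ℝ :=
  ∫ t in (0 : ℝ)..x, waerden N α t

/-- The map `G : ℝ^m → ℝ^{m+1}`, `G(x) = (x^1, …, x^m, F(x^1))`, for `m ≥ 1`. -/
def graphMap (m : ℕ) [NeZero m] (F : ℝ → ℝ) (x : EuclideanSpace ℝ (Fin m)) :
    EuclideanSpace ℝ (Fin (m + 1)) :=
  WithLp.toLp 2 (Fin.snoc (α := fun _ => ℝ) (fun i => x i) (F (x 0)))

/-- The closed unit cube `[0,1]^m`. -/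
def closedCube (m : ℕ) : Set (EuclideanSpace ℝ (Fin m)) :=
  {x | ∀ i, x i ∈ Set.Icc (0 : ℝ) 1}

/-- The open unit cube `(0,1)^m`. -/
def openCube (m : ℕ) : Set (EuclideanSpace ℝ (Fin m)) :=
  {x | ∀ i, x i ∈ Set.Ioo (0 : ℝ) 1}

end

/-! Put `A = N^α` and `B = N^(1-α)`, so that `A * B = N`. On the first half of a period of the
`k`-th saw, the `k`-th term of `f` is affine with slope `2 * B^k`. There the earlier terms vary by
at most `A^(-k) / (B - 1)` and the later ones add at most `A^(-k) / (A - 1)`. For large `N` both are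
small against `A^(-k)`, so after an affine normalization `F` is uniformly close to `t ↦ t^2`
(`abs_waerdenPrimitive_sub_le`).

Hence a fixed nondegenerate simplex inscribed in the graph of `x ↦ (x_0)^2`
(`exists_simplex_on_parabola`) reappears, slightly perturbed, in each of the `N^(km)` cells of side
`N^(-k)`. Its volume is at least of order `N^(-k(m+1)) * A^(-k)` and its diameter at most of order
`N^(-k)`, so its discrete curvature is at least of order `B^k` (`le_discreteCurvature_graphMap`).
The tuples of scale `k` have measure of order `N^(-m(m+1)k)`, while `B^(kp) = N^(m(m+1)k)` by the
choice of `α`: each scale contributes at least a fixed positive amount. As the measures tend to `0`,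
absolute continuity of the integral excludes finite energy (`pEnergy_graphMap_eq_top`).

For regularity, splitting the series for `f` at the scale `|x - y|` gives Hölder continuity
(`exists_holder_waerden`), and charts are the graph map composed with Euclidean motions. -/

/-! ### The saw function. -/

theorem saw_eq_abs_sub_round (x : ℝ) : saw x = 2 * |x - round x| := by
  rw [abs_sub_round_eq_min, saw, tooth]
  split_ifs with h
  · rw [min_eq_left (by linarith)]
  · rw [min_eq_right (by linarith)]; ring

theorem saw_nonneg (x : ℝ) : 0 ≤ saw x := by
  rw [saw_eq_abs_sub_round]; positivity

theorem saw_le_one (x : ℝ) : saw x ≤ 1 := by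
  rw [saw_eq_abs_sub_round]; linarith [abs_sub_round x]

theorem saw_sub_le (x y : ℝ) : saw x - saw y ≤ 2 * |x - y| := by
  rw [saw_eq_abs_sub_round, saw_eq_abs_sub_round]
  -- No integer, in particular `round y`, is closer to `x` than `round x`.
  have h1 := round_le x (round y)
  have h2 := abs_sub_le x y (round y)
  linarith

theorem abs_saw_sub_le (x y : ℝ) : |saw x - saw y| ≤ 2 * |x - y| :=
  abs_le.2 ⟨by linarith [saw_sub_le y x, abs_sub_comm x y], saw_sub_le x y⟩

theorem continuous_saw : Continuous saw :=
  (LipschitzWith.of_dist_le_mul (K := 2) fun x y => by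
    simpa [Real.dist_eq] using abs_saw_sub_le x y).continuous

/-- On the first half of a period the saw is linear. -/
theorem saw_int_add (j : ℤ) {t : ℝ} (h0 : 0 ≤ t) (h1 : t ≤ 1 / 2) : saw (j + t) = 2 * t := by
  rw [saw, Int.fract_intCast_add, Int.fract_eq_self.2 ⟨h0, by linarith⟩, tooth, if_pos h1]

/-- The partial sum of the first `n` terms of the series defining `waerden N α`. -/
noncomputable def waerdenSum (N : ℕ) (α : ℝ) (n : ℕ) (x : ℝ) : ℝ :=
  ∑ k ∈ Finset.range n, saw ((N : ℝ) ^ k * x) / ((N : ℝ) ^ α) ^ k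

/-! ### The series: partial sums, tails and Hölder continuity. -/

section Series

variable {N : ℕ} {α : ℝ}

theorem waerden_eq (x : ℝ) :
    waerden N α x = ∑' k : ℕ, saw ((N : ℝ) ^ k * x) / ((N : ℝ) ^ α) ^ k := by
  unfold waerden
  simp_rw [Real.rpow_mul_natCast (Nat.cast_nonneg N)]

theorem waerden_term_le (hA : 1 < (N : ℝ) ^ α) (k : ℕ) (x : ℝ) :
    saw ((N : ℝ) ^ k * x) / ((N : ℝ) ^ α) ^ k ≤ ((N : ℝ) ^ α)⁻¹ ^ k := by
  rw [inv_pow, div_eq_mul_inv]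
  exact mul_le_of_le_one_left (by positivity) (saw_le_one _)

theorem waerden_term_nonneg (hA : 1 < (N : ℝ) ^ α) (k : ℕ) (x : ℝ) :
    0 ≤ saw ((N : ℝ) ^ k * x) / ((N : ℝ) ^ α) ^ k :=
  div_nonneg (saw_nonneg _) (by positivity)

theorem summable_inv_pow (hA : 1 < (N : ℝ) ^ α) : Summable fun k : ℕ => ((N : ℝ) ^ α)⁻¹ ^ k :=
  summable_geometric_of_lt_one (by positivity) (inv_lt_one_of_one_lt₀ hA)

theorem summable_waerden (hA : 1 < (N : ℝ) ^ α) (x : ℝ) :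
    Summable fun k : ℕ => saw ((N : ℝ) ^ k * x) / ((N : ℝ) ^ α) ^ k :=
  Summable.of_nonneg_of_le (fun k => waerden_term_nonneg hA k x)
    (fun k => waerden_term_le hA k x) (summable_inv_pow hA)

theorem continuous_waerden (hA : 1 < (N : ℝ) ^ α) : Continuous (waerden N α) := by
  have : waerden N α = fun x => ∑' k : ℕ, saw ((N : ℝ) ^ k * x) / ((N : ℝ) ^ α) ^ k :=
    funext waerden_eq
  rw [this]
  refine continuous_tsum (fun k => ?_) (summable_inv_pow hA) fun k x => ?_
  · exact (continuous_saw.comp (continuous_const.mul continuous_id)).div_const _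
  · rw [Real.norm_of_nonneg (waerden_term_nonneg hA k x)]
    exact waerden_term_le hA k x

theorem waerden_sub_sum (hA : 1 < (N : ℝ) ^ α) (n : ℕ) (x : ℝ) :
    waerden N α x - waerdenSum N α n x =
      ∑' k : ℕ, saw ((N : ℝ) ^ (k + n) * x) / ((N : ℝ) ^ α) ^ (k + n) := by
  rw [waerden_eq, ← (summable_waerden hA x).sum_add_tsum_nat_add n, waerdenSum]
  ring

theorem waerdenSum_le_waerden (hA : 1 < (N : ℝ) ^ α) (n : ℕ) (x : ℝ) :
    0 ≤ waerden N α x - waerdenSum N α n x := by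
  rw [waerden_sub_sum hA]
  exact tsum_nonneg fun k => waerden_term_nonneg hA _ x

theorem waerden_sub_sum_le (hA : 1 < (N : ℝ) ^ α) (n : ℕ) (x : ℝ) :
    waerden N α x - waerdenSum N α n x ≤
      (((N : ℝ) ^ α) ^ n)⁻¹ * ((N : ℝ) ^ α / ((N : ℝ) ^ α - 1)) := by
  rw [waerden_sub_sum hA]
  have hs := (summable_nat_add_iff n).2 (summable_waerden hA x)
  have hg := (summable_nat_add_iff n).2 (summable_inv_pow hA)
  refine (hs.tsum_le_tsum (fun k => waerden_term_le hA (k + n) x) hg).trans_eq ?_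
  simp_rw [pow_add]
  rw [tsum_mul_right, tsum_geometric_of_lt_one (by positivity) (inv_lt_one_of_one_lt₀ hA), inv_pow,
    mul_comm]
  congr 1
  have : (N : ℝ) ^ α - 1 ≠ 0 := by linarith
  field_simp

theorem waerden_nonneg (hA : 1 < (N : ℝ) ^ α) (x : ℝ) : 0 ≤ waerden N α x := by
  simpa [waerdenSum] using waerdenSum_le_waerden hA 0 x

theorem waerden_le (hA : 1 < (N : ℝ) ^ α) (x : ℝ) :
    waerden N α x ≤ (N : ℝ) ^ α / ((N : ℝ) ^ α - 1) := by
  simpa [waerdenSum] using waerden_sub_sum_le hA 0 x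

theorem rpow_mul_rpow_one_sub (hN : 0 < N) : (N : ℝ) ^ α * (N : ℝ) ^ (1 - α) = N := by
  rw [← Real.rpow_add (by exact_mod_cast hN)]; simp

/-- The `k`-th term has Lipschitz constant `2 * N^k / A^k = 2 * B^k`; these form a geometric sum
dominated by its last terms. -/
theorem abs_waerdenSum_sub_le (hN : 0 < N) (hB : 1 < (N : ℝ) ^ (1 - α)) (n : ℕ) (x y : ℝ) :
    |waerdenSum N α n x - waerdenSum N α n y| ≤
      2 * |x - y| * (((N : ℝ) ^ (1 - α)) ^ n / ((N : ℝ) ^ (1 - α) - 1)) := by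
  have hN' : (0 : ℝ) < N := by exact_mod_cast hN
  have hA : 0 < (N : ℝ) ^ α := by positivity
  rw [waerdenSum, waerdenSum, ← Finset.sum_sub_distrib]
  calc |∑ k ∈ Finset.range n, (saw ((N : ℝ) ^ k * x) / ((N : ℝ) ^ α) ^ k -
        saw ((N : ℝ) ^ k * y) / ((N : ℝ) ^ α) ^ k)|
      ≤ ∑ k ∈ Finset.range n, 2 * |x - y| * ((N : ℝ) ^ (1 - α)) ^ k := by
        refine (Finset.abs_sum_le_sum_abs _ _).trans (Finset.sum_le_sum fun k _ => ?_)
        rw [← sub_div, abs_div, abs_of_pos (pow_pos hA k), div_le_iff₀ (pow_pos hA k), mul_assoc,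
          ← mul_pow, mul_comm (_ ^ (1 - α)), rpow_mul_rpow_one_sub hN]
        refine (abs_saw_sub_le _ _).trans_eq ?_
        rw [← mul_sub, abs_mul, abs_of_pos (pow_pos hN' k)]
        ring
    _ = 2 * |x - y| * ((((N : ℝ) ^ (1 - α)) ^ n - 1) / ((N : ℝ) ^ (1 - α) - 1)) := by
        rw [← Finset.mul_sum, geom_sum_eq hB.ne']
    _ ≤ _ := by
        have : 0 < (N : ℝ) ^ (1 - α) - 1 := by linarith
        gcongr
        linarith

/-- Low frequencies are controlled by their Lipschitz constants and high frequencies by their size;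
the two bounds balance when the series is cut where `N^(-n)` is about `|x - y|`. -/
theorem exists_holder_waerden (hα0 : 0 < α) (hN : 1 < N)
    (hA : 1 < (N : ℝ) ^ α) (hB : 1 < (N : ℝ) ^ (1 - α)) :
    ∃ C : ℝ, 0 ≤ C ∧ ∀ x y, |waerden N α x - waerden N α y| ≤ C * |x - y| ^ α := by
  set A := (N : ℝ) ^ α with hAdef
  set B := (N : ℝ) ^ (1 - α) with hBdef
  have hN0 : 0 < N := by omega
  have hN1 : (1 : ℝ) < N := by exact_mod_cast hN
  have hA1 : 0 < A - 1 := by linarith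
  have hB1 : 0 < B - 1 := by linarith
  have hA0 : 0 < A := by linarith
  have hB0 : 0 < B := by linarith
  refine ⟨2 * (B / (B - 1)) + A / (A - 1), by positivity, fun x y => ?_⟩
  have hb : ∀ n, |waerden N α x - waerden N α y| ≤
      2 * |x - y| * (B ^ n / (B - 1)) + (A ^ n)⁻¹ * (A / (A - 1)) := by
    intro n
    have h1 := abs_le.1 (abs_waerdenSum_sub_le hN0 hB n x y)
    have h2 := waerdenSum_le_waerden hA n x
    have h3 := waerdenSum_le_waerden hA n y
    have h4 := waerden_sub_sum_le hA n x
    have h5 := waerden_sub_sum_le hA n y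
    rw [abs_le]
    constructor <;> linarith [h1.1, h1.2]
  rcases eq_or_ne x y with rfl | hxy
  · simp [Real.zero_rpow hα0.ne']
  have hd : 0 < |x - y| := abs_pos.2 (sub_ne_zero.2 hxy)
  set d := |x - y| with hddef
  rcases le_or_gt 1 d with h1 | h1
  · have h2 : 1 ≤ d ^ α := Real.one_le_rpow h1 hα0.le
    have h3 := abs_le.2 (⟨by linarith [waerden_nonneg hA x, waerden_le hA y],
      by linarith [waerden_nonneg hA y, waerden_le hA x]⟩ :
        -(A / (A - 1)) ≤ waerden N α x - waerden N α y ∧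
          waerden N α x - waerden N α y ≤ A / (A - 1))
    have h4 : 0 ≤ A / (A - 1) := by positivity
    have h5 : 0 ≤ 2 * (B / (B - 1)) := by positivity
    nlinarith
  -- Here `N^n ≤ 1/d < N^(n+1)`, and the series is cut after `n + 1` terms.
  obtain ⟨n, hn1, hn2⟩ := exists_nat_pow_near (one_le_inv₀ hd |>.2 h1.le) hN1
  have hAB : ∀ k, A ^ k = ((N : ℝ) ^ k) ^ α ∧ B ^ k = ((N : ℝ) ^ k) ^ (1 - α) := fun k =>
    ⟨by rw [Real.rpow_pow_comm (by positivity)], by rw [Real.rpow_pow_comm (by positivity)]⟩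
  have hα1 : 0 ≤ 1 - α := by
    by_contra h
    exact absurd hB (not_lt.2 (Real.rpow_le_one_of_one_le_of_nonpos hN1.le (by linarith)))
  have hBn : d * B ^ n ≤ d ^ α := by
    calc d * B ^ n ≤ d * (d⁻¹) ^ (1 - α) := by
          rw [(hAB n).2]; gcongr
      _ = d ^ α := by
          rw [Real.inv_rpow hd.le, ← Real.rpow_neg hd.le]
          nth_rewrite 1 [← Real.rpow_one d]
          rw [← Real.rpow_add hd]; congr 1; ring
  have hAn : (A ^ (n + 1))⁻¹ ≤ d ^ α := by
    rw [(hAB _).1, ← Real.inv_rpow (by positivity)]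
    refine Real.rpow_le_rpow (by positivity) ?_ hα0.le
    rw [inv_le_comm₀ (by positivity) hd]
    exact hn2.le
  calc _ ≤ _ := hb (n + 1)
    _ = 2 * (B / (B - 1)) * (d * B ^ n) + A / (A - 1) * (A ^ (n + 1))⁻¹ := by ring
    _ ≤ 2 * (B / (B - 1)) * d ^ α + A / (A - 1) * d ^ α := by gcongr
    _ = _ := by ring

/-! ### The primitive and its parabolic arcs. -/

theorem hasDerivAt_waerdenPrimitive (hA : 1 < (N : ℝ) ^ α) (x : ℝ) :
    HasDerivAt (waerdenPrimitive N α) (waerden N α x) x :=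
  intervalIntegral.integral_hasDerivAt_right ((continuous_waerden hA).intervalIntegrable _ _)
    ((continuous_waerden hA).stronglyMeasurableAtFilter _ _) (continuous_waerden hA).continuousAt

/-- On the first half of the `j`-th period of the `k`-th saw, the function `waerden N α` is close to
an affine function. -/
theorem abs_waerden_sub_affine_le (hN : 0 < N) (hA : 1 < (N : ℝ) ^ α)
    (hB : 1 < (N : ℝ) ^ (1 - α)) (k j : ℕ) {s : ℝ} (h0 : 0 ≤ s) (h1 : s ≤ 1 / 2) :
    |waerden N α (((N : ℝ) ^ k)⁻¹ * (j + s)) - waerdenSum N α k (((N : ℝ) ^ k)⁻¹ * j) -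
        (((N : ℝ) ^ α) ^ k)⁻¹ * (2 * s)| ≤
      (((N : ℝ) ^ α) ^ k)⁻¹ * (((N : ℝ) ^ (1 - α) - 1)⁻¹ + ((N : ℝ) ^ α - 1)⁻¹) := by
  set A := (N : ℝ) ^ α with hAdef
  set B := (N : ℝ) ^ (1 - α) with hBdef
  have hN' : (0 : ℝ) < N := by exact_mod_cast hN
  have hA1 : 0 < A - 1 := by linarith
  have hB1 : 0 < B - 1 := by linarith
  have hA0 : 0 < A := by linarith
  have hB0 : 0 < B := by linarith
  have hAB : A * B = N := rpow_mul_rpow_one_sub hN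
  set x := ((N : ℝ) ^ k)⁻¹ * (j + s) with hx
  set b := ((N : ℝ) ^ k)⁻¹ * (j : ℝ) with hb
  have hsaw : saw ((N : ℝ) ^ k * x) = 2 * s := by
    rw [hx, mul_inv_cancel_left₀ (by positivity)]
    exact_mod_cast saw_int_add (j : ℤ) h0 h1
  have hsum : waerdenSum N α (k + 1) x = waerdenSum N α k x + (A ^ k)⁻¹ * (2 * s) := by
    rw [waerdenSum, Finset.sum_range_succ, hsaw, waerdenSum, ← hAdef]; ring
  have hlow := abs_waerdenSum_sub_le hN hB k x b
  have hxb : |x - b| = ((N : ℝ) ^ k)⁻¹ * s := by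
    rw [hx, hb, ← mul_sub, add_sub_cancel_left, abs_of_nonneg (by positivity)]
  have hle : 2 * |x - b| * (B ^ k / (B - 1)) ≤ (A ^ k)⁻¹ * (B - 1)⁻¹ := by
    have h2 : ((N : ℝ) ^ k)⁻¹ * B ^ k = (A ^ k)⁻¹ := by
      rw [← hAB, mul_pow]; field_simp
    calc 2 * |x - b| * (B ^ k / (B - 1)) = (2 * s) * ((((N : ℝ) ^ k)⁻¹ * B ^ k) * (B - 1)⁻¹) := by
          rw [hxb]; ring
      _ ≤ 1 * ((((N : ℝ) ^ k)⁻¹ * B ^ k) * (B - 1)⁻¹) := by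
          gcongr; linarith
      _ = _ := by rw [h2, one_mul]
  have h3 := waerdenSum_le_waerden hA (k + 1) x
  have h4 := waerden_sub_sum_le hA (k + 1) x
  have h5 : (A ^ (k + 1))⁻¹ * (A / (A - 1)) = (A ^ k)⁻¹ * (A - 1)⁻¹ := by
    rw [pow_succ]; field_simp
  rw [← hAdef, h5, hsum] at h4
  rw [hsum] at h3
  have h6 := abs_le.1 (hlow.trans hle)
  have h7 : 0 ≤ (A ^ k)⁻¹ * (A - 1)⁻¹ := by positivity
  rw [mul_add, abs_le]
  constructor <;> linarith [h6.1, h6.2]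

/-- After affine normalization, `waerdenPrimitive N α` is close to a parabola on the first half of
the `j`-th period of the `k`-th saw. -/
theorem abs_waerdenPrimitive_sub_le (hN : 0 < N) (hA : 1 < (N : ℝ) ^ α)
    (hB : 1 < (N : ℝ) ^ (1 - α)) (k j : ℕ) {t : ℝ} (h0 : 0 ≤ t) (h1 : t ≤ 1 / 2) :
    |(waerdenPrimitive N α (((N : ℝ) ^ k)⁻¹ * (j + t)) -
          waerdenPrimitive N α (((N : ℝ) ^ k)⁻¹ * j) -
          ((N : ℝ) ^ k)⁻¹ * waerdenSum N α k (((N : ℝ) ^ k)⁻¹ * j) * t) *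
        ((N : ℝ) ^ k * ((N : ℝ) ^ α) ^ k) - t ^ 2| ≤
      ((N : ℝ) ^ (1 - α) - 1)⁻¹ + ((N : ℝ) ^ α - 1)⁻¹ := by
  set A := (N : ℝ) ^ α with hAdef
  set B := (N : ℝ) ^ (1 - α) with hBdef
  set ε := (B - 1)⁻¹ + (A - 1)⁻¹ with hε
  have hN' : (0 : ℝ) < N := by exact_mod_cast hN
  have hA1 : 0 < A - 1 := by linarith
  have hB1 : 0 < B - 1 := by linarith
  have hA0 : 0 < A := by linarith
  have hε0 : 0 ≤ ε := by positivity
  set M := (N : ℝ) ^ k with hM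
  have hM0 : 0 < M := by positivity
  set c := waerdenSum N α k (M⁻¹ * j) with hc
  -- Up to an additive constant, `g` is the normalized primitive minus the parabola; its derivative
  -- is the affine error of `waerden`, so the mean value inequality applies.
  set g : ℝ → ℝ := fun s => (waerdenPrimitive N α (M⁻¹ * (j + s)) - M⁻¹ * c * s) * (M * A ^ k)
    - s ^ 2 with hg
  have hd : ∀ s, HasDerivAt g
      ((waerden N α (M⁻¹ * (j + s)) * M⁻¹ - M⁻¹ * c) * (M * A ^ k) - 2 * s) s := by
    intro s
    have e1 : HasDerivAt (fun s : ℝ => M⁻¹ * (j + s)) M⁻¹ s := by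
      simpa using ((hasDerivAt_id s).const_add (j : ℝ)).const_mul M⁻¹
    have e2 := (hasDerivAt_waerdenPrimitive hA (M⁻¹ * (j + s))).comp s e1
    have e3 : HasDerivAt (fun s : ℝ => M⁻¹ * c * s) (M⁻¹ * c) s := by
      simpa using (hasDerivAt_id s).const_mul (M⁻¹ * c)
    have e4 : HasDerivAt (fun s : ℝ => s ^ 2) (2 * s) s := by
      simpa using hasDerivAt_pow 2 s
    exact ((e2.sub e3).mul_const _).sub e4
  have hbound : ∀ s ∈ Set.Icc (0 : ℝ) (1 / 2),
      ‖(waerden N α (M⁻¹ * (j + s)) * M⁻¹ - M⁻¹ * c) * (M * A ^ k) - 2 * s‖ ≤ ε := by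
    intro s hs
    have := abs_waerden_sub_affine_le hN hA hB k j hs.1 hs.2
    have e : (waerden N α (M⁻¹ * (j + s)) * M⁻¹ - M⁻¹ * c) * (M * A ^ k) - 2 * s =
        (waerden N α (M⁻¹ * (j + s)) - c - (A ^ k)⁻¹ * (2 * s)) * A ^ k := by
      field_simp
    rw [e, Real.norm_eq_abs, abs_mul, abs_of_pos (pow_pos hA0 k)]
    calc _ ≤ ((A ^ k)⁻¹ * ε) * A ^ k := by gcongr
      _ = ε := by field_simp
  have key := (convex_Icc (0 : ℝ) (1 / 2)).norm_image_sub_le_of_norm_hasDerivWithin_le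
    (fun s _ => (hd s).hasDerivWithinAt) hbound (x := 0) (y := t) ⟨le_rfl, by norm_num⟩ ⟨h0, h1⟩
  have e : g t - g 0 = (waerdenPrimitive N α (M⁻¹ * (j + t)) -
      waerdenPrimitive N α (M⁻¹ * j) - M⁻¹ * c * t) * (M * A ^ k) - t ^ 2 := by
    simp only [hg, add_zero]; ring
  rw [e, Real.norm_eq_abs, sub_zero, Real.norm_of_nonneg h0] at key
  refine key.trans ?_
  nlinarith

end Series

/-- The projection of `ℝ^(m+1)` to the first `m` coordinates. -/
noncomputable def dropLast (m : ℕ) :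
    EuclideanSpace ℝ (Fin (m + 1)) →L[ℝ] EuclideanSpace ℝ (Fin m) :=
  LinearMap.toContinuousLinearMap
    { toFun := fun y => WithLp.toLp 2 fun i => y i.castSucc
      map_add' := fun _ _ => rfl
      map_smul' := fun _ _ => rfl }

/-- The inclusion `x ↦ (x, 0)` of `ℝ^m` into `ℝ^(m+1)`. -/
noncomputable def appendZero (m : ℕ) :
    EuclideanSpace ℝ (Fin m) →L[ℝ] EuclideanSpace ℝ (Fin (m + 1)) :=
  LinearMap.toContinuousLinearMap
    { toFun := fun x => WithLp.toLp 2 (Fin.snoc (α := fun _ => ℝ) (fun i => x i) 0)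
      map_add' := fun x y => by
        ext i; refine Fin.lastCases ?_ (fun j => ?_) i <;> simp
      map_smul' := fun c x => by
        ext i; refine Fin.lastCases ?_ (fun j => ?_) i <;> simp }

/-! ### Graphs and their charts. -/

section Graph

variable {m : ℕ}

@[simp]
theorem dropLast_apply (y : EuclideanSpace ℝ (Fin (m + 1))) (i : Fin m) :
    dropLast m y i = y i.castSucc := rfl

@[simp]
theorem appendZero_castSucc (x : EuclideanSpace ℝ (Fin m)) (i : Fin m) :
    appendZero m x i.castSucc = x i := by
  simp [appendZero]

@[simp]
theorem appendZero_last (x : EuclideanSpace ℝ (Fin m)) : appendZero m x (Fin.last m) = 0 := by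
  simp [appendZero]

theorem lipschitzWith_dropLast : LipschitzWith 1 (dropLast m) := by
  refine LipschitzWith.of_dist_le_mul fun x y => ?_
  rw [NNReal.coe_one, one_mul, EuclideanSpace.dist_eq, EuclideanSpace.dist_eq,
    Fin.sum_univ_castSucc]
  exact Real.sqrt_le_sqrt (le_add_of_nonneg_right (by positivity))

variable [NeZero m] {F f : ℝ → ℝ} {α : ℝ}

@[simp]
theorem graphMap_castSucc (x : EuclideanSpace ℝ (Fin m)) (i : Fin m) :
    graphMap m F x i.castSucc = x i := by
  simp [graphMap]

@[simp]
theorem graphMap_last (x : EuclideanSpace ℝ (Fin m)) :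
    graphMap m F x (Fin.last m) = F (x 0) := by
  simp [graphMap]

@[simp]
theorem dropLast_graphMap (x : EuclideanSpace ℝ (Fin m)) : dropLast m (graphMap m F x) = x := by
  ext i; simp

theorem graphMap_injective : Function.Injective (graphMap m F) :=
  Function.LeftInverse.injective dropLast_graphMap

theorem graphMap_eq : graphMap m F = fun x => appendZero m x +
    F (EuclideanSpace.proj (𝕜 := ℝ) (0 : Fin m) x) • EuclideanSpace.single (Fin.last m) (1 : ℝ) := by
  ext x i
  refine Fin.lastCases ?_ (fun j => ?_) i
  · simp
  · simp [(Fin.castSucc_lt_last j).ne]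

theorem hasFDerivAt_graphMap (hF : ∀ t, HasDerivAt F (f t) t) (x : EuclideanSpace ℝ (Fin m)) :
    HasFDerivAt (graphMap m F) (appendZero m + f (x 0) •
      (EuclideanSpace.proj (𝕜 := ℝ) (0 : Fin m)).smulRight
        (EuclideanSpace.single (Fin.last m) (1 : ℝ))) x := by
  rw [graphMap_eq]
  refine (appendZero m).hasFDerivAt.add ?_
  have := ((hF (x 0)).comp_hasFDerivAt (f := fun y => EuclideanSpace.proj (𝕜 := ℝ) (0 : Fin m) y) x
    (EuclideanSpace.proj (𝕜 := ℝ) (0 : Fin m)).hasFDerivAt).smul_const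
      (EuclideanSpace.single (Fin.last m) (1 : ℝ))
  refine this.congr_fderiv ?_
  ext v : 1
  simp [mul_smul]

/-- Differentiating `dropLast ∘ graphMap = id` provides a left inverse of the derivative. -/
theorem fderiv_graphMap_injective (hF : ∀ t, HasDerivAt F (f t) t)
    (x : EuclideanSpace ℝ (Fin m)) : Function.Injective (fderiv ℝ (graphMap m F) x) := by
  have h := (dropLast m).hasFDerivAt.comp x (hasFDerivAt_graphMap hF x)
  have h2 : (dropLast m ∘ graphMap m F) = id := funext dropLast_graphMap
  rw [h2, ← (hasFDerivAt_graphMap hF x).fderiv] at h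
  have h3 := h.unique (hasFDerivAt_id x)
  exact Function.LeftInverse.injective (g := dropLast m) fun v => congrArg (fun L => L v) h3

theorem contDiff_of_hasDerivAt (hF : ∀ t, HasDerivAt F (f t) t) (hf : Continuous f) :
    ContDiff ℝ 1 F := by
  rw [contDiff_one_iff_deriv]
  have : deriv F = f := funext fun t => (hF t).deriv
  exact ⟨fun t => (hF t).differentiableAt, this ▸ hf⟩

theorem isC1Holder_of_hasDerivAt (hF : ∀ t, HasDerivAt F (f t) t) (hf : Continuous f)
    {C : ℝ} (hC : ∀ s t, |f s - f t| ≤ C * |s - t| ^ α) : IsC1Holder α F Set.univ := by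
  refine ⟨(contDiff_of_hasDerivAt hF hf).contDiffOn, C, fun s _ t _ => ?_⟩
  rw [(hF s).hasFDerivAt.fderiv, (hF t).hasFDerivAt.fderiv]
  have e : ContinuousLinearMap.toSpanSingleton ℝ (f s) - ContinuousLinearMap.toSpanSingleton ℝ (f t) =
      ContinuousLinearMap.toSpanSingleton ℝ (f s - f t) := by
    ext; simp
  rw [e, ContinuousLinearMap.norm_toSpanSingleton]
  exact hC s t

theorem isC1Holder_graphMap (hF : ∀ t, HasDerivAt F (f t) t) (hf : Continuous f) (hα : 0 ≤ α)
    {C : ℝ} (hC0 : 0 ≤ C) (hC : ∀ s t, |f s - f t| ≤ C * |s - t| ^ α) :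
    IsC1Holder α (graphMap m F) Set.univ := by
  have hcd : ContDiff ℝ 1 (graphMap m F) := by
    rw [graphMap_eq]
    exact (appendZero m).contDiff.add (((contDiff_of_hasDerivAt hF hf).comp
      (EuclideanSpace.proj (𝕜 := ℝ) (0 : Fin m)).contDiff).smul contDiff_const)
  set M := (EuclideanSpace.proj (𝕜 := ℝ) (0 : Fin m)).smulRight
        (EuclideanSpace.single (Fin.last m) (1 : ℝ))
  refine ⟨hcd.contDiffOn, C * ‖M‖, fun x _ y _ => ?_⟩
  rw [(hasFDerivAt_graphMap hF x).fderiv, (hasFDerivAt_graphMap hF y).fderiv, add_sub_add_left_eq_sub,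
    ← sub_smul, norm_smul]
  have h1 : |x 0 - y 0| ≤ ‖x - y‖ := by
    simpa using PiLp.norm_apply_le (x - y) 0
  calc ‖f (x 0) - f (y 0)‖ * ‖M‖ ≤ (C * ‖x - y‖ ^ α) * ‖M‖ := by
        gcongr
        exact (hC _ _).trans (by gcongr)
    _ = _ := by ring

theorem IsC1Holder.comp_isometry {E E' F' : Type*} [NormedAddCommGroup E] [NormedSpace ℝ E]
    [NormedAddCommGroup E'] [NormedSpace ℝ E'] [NormedAddCommGroup F'] [NormedSpace ℝ F']
    {φ : E' → F'} (h : IsC1Holder α φ Set.univ) (D : E ≃ₗᵢ[ℝ] E') (c : E') (W : Set E) :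
    IsC1Holder α (fun x => φ (D x + c)) W := by
  obtain ⟨h1, C, hC⟩ := h
  have h1' : ContDiff ℝ 1 φ := contDiffOn_univ.1 h1
  have hτ : ∀ x, HasFDerivAt (fun x => D x + c) (D : E →L[ℝ] E') x := fun x =>
    (D : E →L[ℝ] E').hasFDerivAt.add_const c
  have hd : ∀ x, fderiv ℝ (fun x => φ (D x + c)) x = (fderiv ℝ φ (D x + c)).comp (D : E →L[ℝ] E') :=
    fun x => (((h1'.differentiable one_ne_zero) _).hasFDerivAt.comp x (hτ x)).fderiv
  refine ⟨(h1'.comp (D.contDiff.add contDiff_const)).contDiffOn, C, fun x _ y _ => ?_⟩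
  rw [hd, hd, ← ContinuousLinearMap.sub_comp]
  have := hC (D x + c) trivial (D y + c) trivial
  rw [add_sub_add_right_eq_sub, ← map_sub, D.norm_map] at this
  exact (ContinuousLinearMap.opNorm_comp_linearIsometryEquiv _ D).trans_le this

/-- A Euclidean motion straightening a piece of `Q` to a piece of a corner gives a chart of the
graph over `Q`. -/
theorem hasC1HolderChartAt_graphMap (hF : ∀ t, HasDerivAt F (f t) t)
    (hG : IsC1Holder α (graphMap m F) Set.univ) {s : Finset (Fin m)}
    {Q V W : Set (EuclideanSpace ℝ (Fin m))} (hV : IsOpen V) (hW : IsOpen W)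
    (D : EuclideanSpace ℝ (Fin m) ≃ₗᵢ[ℝ] EuclideanSpace ℝ (Fin m))
    (c : EuclideanSpace ℝ (Fin m)) (h : (fun x => D x + c) '' (W ∩ cornerModel m s) = Q ∩ V)
    {x : EuclideanSpace ℝ (Fin m)} (hx : x ∈ V) :
    HasC1HolderChartAt m α s (graphMap m F '' Q) (graphMap m F x) := by
  -- The neighbourhood is the cylinder over `V`, which meets the graph over `Q` exactly in the graph
  -- over `Q ∩ V`.
  refine ⟨dropLast m ⁻¹' V, W, fun x => graphMap m F (D x + c),
    fun y => D.symm (dropLast m y - c), hV.preimage (dropLast m).continuous, by simpa using hx, hW,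
    hG.comp_isometry D c W, fun y _ => ?_, ?_, ?_, ?_⟩
  · have e : fderiv ℝ (fun x => graphMap m F (D x + c)) y =
        (fderiv ℝ (graphMap m F) (D y + c)).comp
          (D : EuclideanSpace ℝ (Fin m) →L[ℝ] EuclideanSpace ℝ (Fin m)) :=
      ((hasFDerivAt_graphMap hF _).differentiableAt.hasFDerivAt.comp y
        ((D : EuclideanSpace ℝ (Fin m) →L[ℝ] EuclideanSpace ℝ (Fin m)).hasFDerivAt.add_const
          c)).fderiv
    rw [e]
    exact (fderiv_graphMap_injective hF _).comp D.injective
  · rw [← Set.image_image (graphMap m F) (fun x => D x + c), h]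
    ext y
    constructor
    · rintro ⟨z, ⟨hz, hz'⟩, rfl⟩
      exact ⟨⟨z, hz, rfl⟩, by simpa using hz'⟩
    · rintro ⟨⟨z, hz, rfl⟩, hz'⟩
      exact ⟨z, ⟨hz, by simpa using hz'⟩, rfl⟩
  · exact (D.symm.continuous.comp ((dropLast m).continuous.sub continuous_const)).continuousOn
  · intro y _
    simp

theorem isOpen_forall_coord_mem {ι : Type*} [Finite ι] {u : ι → Set ℝ} (hu : ∀ i, IsOpen (u i)) :
    IsOpen {x : EuclideanSpace ℝ ι | ∀ i, x i ∈ u i} := by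
  simp only [Set.ofPred_forall]
  exact isOpen_iInter_of_finite fun i =>
    (hu i).preimage (EuclideanSpace.proj (𝕜 := ℝ) i).continuous

theorem isC1HolderManifold_graphMap (hF : ∀ t, HasDerivAt F (f t) t)
    (hG : IsC1Holder α (graphMap m F) Set.univ) {Q : Set (EuclideanSpace ℝ (Fin m))}
    (hQ : IsOpen Q) : IsC1HolderManifold m α (graphMap m F '' Q) := by
  rintro _ ⟨x, hx, rfl⟩
  refine hasC1HolderChartAt_graphMap hF hG hQ hQ (.refl ℝ _) 0 ?_ hx
  simp [cornerModel]

theorem isC1HolderManifoldWithCorners_graphMap (hF : ∀ t, HasDerivAt F (f t) t)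
    (hG : IsC1Holder α (graphMap m F) Set.univ) :
    IsC1HolderManifoldWithCorners m α (graphMap m F '' closedCube m) := by
  classical
  rintro _ ⟨x, hx, rfl⟩
  -- The full corner serves at every point, since the point need not go to the vertex. Coordinates
  -- with `x i = 1` are reflected by `t ↦ 1 - t`, so `[0,1)^m` covers the cube minus the faces
  -- opposite to those chosen.
  refine ⟨Finset.univ, hasC1HolderChartAt_graphMap hF hG
    (V := {y | ∀ i, y i ∈ if x i < 1 then Set.Iio (1 : ℝ) else Set.Ioi 0})
    (W := {y | ∀ i, y i ∈ Set.Ioo (-1 : ℝ) 1})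
    (isOpen_forall_coord_mem fun i => by split_ifs; exacts [isOpen_Iio, isOpen_Ioi])
    (isOpen_forall_coord_mem fun i => isOpen_Ioo)
    (LinearIsometryEquiv.piLpCongrRight 2 fun i =>
      if x i < 1 then LinearIsometryEquiv.refl ℝ ℝ else LinearIsometryEquiv.neg ℝ)
    (WithLp.toLp 2 fun i => if x i < 1 then 0 else 1) ?_ ?_⟩
  · ext y
    constructor
    · rintro ⟨z, ⟨hz, hz'⟩, rfl⟩
      refine ⟨fun i => ?_, fun i => ?_⟩ <;>
      · have h1 := hz i
        have h2 := hz' i (Finset.mem_univ i)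
        by_cases hi : x i < 1 <;> simp [hi, LinearIsometryEquiv.piLpCongrRight_apply] at h1 h2 ⊢ <;>
          grind
    · rintro ⟨hy, hy'⟩
      refine ⟨WithLp.toLp 2 fun i => if x i < 1 then y i else 1 - y i, ⟨fun i => ?_, fun i _ => ?_⟩, ?_⟩
      · have h1 := hy i
        have h2 := hy' i
        by_cases hi : x i < 1 <;> simp [hi] at h1 h2 ⊢ <;> grind
      · have h1 := hy i
        by_cases hi : x i < 1 <;> simp [hi] at h1 ⊢ <;> grind
      · ext i
        by_cases hi : x i < 1 <;> simp [hi, LinearIsometryEquiv.piLpCongrRight_apply]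
  · intro i
    by_cases hi : x i < 1
    · simp [hi]
    · simp [hi]; linarith

theorem continuous_graphMap (hF : Continuous F) : Continuous (graphMap m F) := by
  rw [graphMap_eq]
  fun_prop

end Graph

/-! ### The cube and monotonicity of product measures. -/

theorem isCompact_closedCube (m : ℕ) : IsCompact (closedCube m) := by
  have : closedCube m = WithLp.ofLp ⁻¹' (Set.univ.pi fun _ : Fin m => Set.Icc (0 : ℝ) 1) := by
    ext x; simp [closedCube, Pi.le_def, forall_and]
  rw [this]
  exact (PiLp.homeomorph 2 fun _ : Fin m => ℝ).isCompact_preimage.2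
    (isCompact_univ_pi fun _ => isCompact_Icc)

/-- `OuterMeasure.pi` is the largest outer measure bounded on boxes by the product, so it is
monotone in the factors. No σ-finiteness is needed, which matters for Hausdorff measure on an
arbitrary set. -/
theorem MeasureTheory.Measure.pi_le_pi {ι : Type*} [Fintype ι] {X : ι → Type*}
    [∀ i, MeasurableSpace (X i)] {μ ν : ∀ i, Measure (X i)} (h : ∀ i, μ i ≤ ν i) :
    Measure.pi μ ≤ Measure.pi ν := by
  refine Measure.le_intro fun s hs _ => ?_
  rw [Measure.pi, Measure.pi, toMeasure_apply _ _ hs, toMeasure_apply _ _ hs]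
  refine (OuterMeasure.le_pi.2 fun t _ => ?_ : OuterMeasure.pi _ ≤ OuterMeasure.pi _) s
  exact (OuterMeasure.pi_pi_le _ t).trans (Finset.prod_le_prod' fun i _ => h i (t i))

/-! ### Volumes of simplices. -/

/-- The determinant of the edge vectors at the first vertex of the simplex with vertices `V`. -/
noncomputable def simplexDet {n : ℕ} (V : Fin (n + 1) → Fin n → ℝ) : ℝ :=
  (Matrix.of fun (i : Fin n) (j : Fin n) => V i.succ j - V 0 j).det

theorem continuous_simplexDet {n : ℕ} :
    Continuous (simplexDet : (Fin (n + 1) → Fin n → ℝ) → ℝ) := by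
  refine Continuous.matrix_det (continuous_matrix fun i j => ?_)
  simp only [Matrix.of_apply]
  fun_prop

/-- The standard simplex with vertices `0, e_1, …, e_n`. -/
noncomputable def cornerSimplex (n : ℕ) : Set (EuclideanSpace ℝ (Fin n)) :=
  convexHull ℝ (insert 0 (Set.range fun i : Fin n => EuclideanSpace.single i (1 : ℝ)))

theorem volume_cornerSimplex_pos (n : ℕ) : 0 < volume (cornerSimplex n) := by
  refine Measure.measure_pos_of_nonempty_interior _ ?_
  rw [cornerSimplex, interior_convexHull_nonempty_iff_affineSpan_eq_top]
  apply SetLike.coe_injective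
  rw [affineSpan_insert_zero]
  have h := (EuclideanSpace.basisFun (Fin n) ℝ).toBasis.span_eq
  have e : (⇑(EuclideanSpace.basisFun (Fin n) ℝ).toBasis) =
      fun i : Fin n => EuclideanSpace.single i (1 : ℝ) := by
    ext i; simp
  rw [e] at h
  rw [h]
  rfl

/-- The simplex is the image of the standard one under the affine map sending `e_i` to the vertices,
whose linear part has the edge vectors as columns. -/
theorem volume_convexHull_range {n : ℕ} (T : Fin (n + 1) → EuclideanSpace ℝ (Fin n)) :
    volume (convexHull ℝ (Set.range T)) =
      ENNReal.ofReal |simplexDet fun i j => T i j| * volume (cornerSimplex n) := by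
  set M : Matrix (Fin n) (Fin n) ℝ := Matrix.of fun i j => T i.succ j - T 0 j with hM
  set L : EuclideanSpace ℝ (Fin n) →ₗ[ℝ] EuclideanSpace ℝ (Fin n) :=
    Matrix.toEuclideanLin M.transpose with hL
  have hdet : LinearMap.det L = simplexDet fun i j => T i j := by
    rw [hL, Matrix.toEuclideanLin_eq_toLin_orthonormal, LinearMap.det_toLin, Matrix.det_transpose]
    rfl
  have hLe : ∀ i, L (EuclideanSpace.single i (1 : ℝ)) = T i.succ - T 0 := by
    intro i
    ext j
    simp [hL, hM, Matrix.toLpLin_apply]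
  let f : EuclideanSpace ℝ (Fin n) →ᵃ[ℝ] EuclideanSpace ℝ (Fin n) :=
    L.toAffineMap + AffineMap.const ℝ _ (T 0)
  have hf : ∀ x, f x = L x + T 0 := fun x => rfl
  have hT : Set.range T =
      f '' insert 0 (Set.range fun i : Fin n => EuclideanSpace.single i (1 : ℝ)) := by
    rw [Set.image_insert_eq, ← Set.range_comp, hf, map_zero, zero_add]
    ext y
    constructor
    · rintro ⟨i, rfl⟩
      refine Fin.cases (Or.inl rfl) (fun j => Or.inr ⟨j, ?_⟩) i
      simp [hf, hLe]
    · rintro (rfl | ⟨j, rfl⟩)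
      · exact ⟨0, rfl⟩
      · exact ⟨j.succ, by simp [hf, hLe]⟩
  have hcomp : ⇑f = (fun y => y + T 0) ∘ L := rfl
  rw [hT, ← AffineMap.image_convexHull, hcomp, Set.image_comp, Set.image_add_right,
    measure_preimage_add_right, Measure.addHaar_image_linearMap, hdet]
  rfl

/-- Behaviour of `simplexDet` under the affine change of coordinates
`(x, y) ↦ (r • x + a, r * c * x_0 + ρ * y + z)`. -/
theorem simplexDet_snoc_affine {m : ℕ} [NeZero m] (u : Fin (m + 2) → Fin m → ℝ)
    (v : Fin (m + 2) → ℝ) (a : Fin m → ℝ) (r c ρ z : ℝ) :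
    simplexDet (fun i => Fin.snoc (α := fun _ => ℝ) (fun j => r * u i j + a j)
        (r * c * u i 0 + ρ * v i + z)) =
      r ^ m * ρ * simplexDet (fun i => Fin.snoc (α := fun _ => ℝ) (u i) (v i)) := by
  classical
  -- Translations cancel in the edge vectors, and the remaining map multiplies the edge matrix on
  -- the right by this upper triangular `L`.
  set L : Matrix (Fin (m + 1)) (Fin (m + 1)) ℝ := Matrix.of fun j j' =>
    if j = j' then (if j' = Fin.last m then ρ else r)
    else if j = Fin.castSucc 0 ∧ j' = Fin.last m then r * c else 0 with hL
  have hLdet : L.det = r ^ m * ρ := by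
    rw [Matrix.det_of_isUpperTriangular, Fin.prod_univ_castSucc]
    · simp [hL, (Fin.castSucc_lt_last _).ne]
    · intro i j hij
      have hij' : j < i := hij
      have h1 : j ≠ Fin.last m := (hij'.trans_le (Fin.le_last i)).ne
      simp [hL, hij'.ne', h1]
  rw [simplexDet, simplexDet, ← hLdet, mul_comm L.det, ← Matrix.det_mul]
  congr 1
  ext i j
  rw [Matrix.mul_apply, Fin.sum_univ_castSucc]
  refine Fin.lastCases ?_ (fun l => ?_) j
  · simp [hL, (Fin.castSucc_lt_last _).ne]
    ring
  · simp [hL, (Fin.castSucc_lt_last _).ne']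
    ring

/-- A nondegenerate simplex inscribed in the graph of `x ↦ (x_0)²`, together with a lower bound for
the determinants of nearby simplices. -/
theorem exists_simplex_on_parabola (m : ℕ) [NeZero m] :
    ∃ (w : Fin (m + 2) → Fin m → ℝ) (δ d : ℝ), 0 < δ ∧ δ ≤ 1 / 8 ∧ 0 < d ∧
      (∀ i j, w i j ∈ Set.Icc (1 / 8 : ℝ) (3 / 8)) ∧
      ∀ (u : Fin (m + 2) → Fin m → ℝ) (v : Fin (m + 2) → ℝ), (∀ i j, |u i j - w i j| < δ) →
        (∀ i, |v i - w i 0 ^ 2| < δ) →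
        d ≤ |simplexDet (fun i => Fin.snoc (α := fun _ => ℝ) (u i) (v i))| := by
  classical
  -- The base point `b = (1/8, …, 1/8)`, the points `b + e_l / 8`, and `b + e_0 / 4`. The three
  -- points on the line through `b` in direction `e_0` lift to noncollinear points of the parabola.
  let w : Fin (m + 2) → Fin m → ℝ := Fin.cons (fun _ => 1 / 8)
    (Fin.snoc (α := fun _ => Fin m → ℝ) (fun l j => if j = l then 1 / 4 else 1 / 8)
      (fun j => if j = 0 then 3 / 8 else 1 / 8))
  have w0 : ∀ j, w 0 j = 1 / 8 := fun j => rfl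
  have w1 : ∀ l j, w (Fin.succ (Fin.castSucc l)) j = if j = l then 1 / 4 else 1 / 8 := fun l j => by
    simp [w]
  have w2 : ∀ j, w (Fin.succ (Fin.last m)) j = if j = 0 then 3 / 8 else 1 / 8 := fun j => by
    simp [w, -Fin.succ_last]
  let W : Fin (m + 2) → Fin (m + 1) → ℝ :=
    fun i => Fin.snoc (α := fun _ => ℝ) (w i) (w i 0 ^ 2)
  have hW : simplexDet W ≠ 0 := by
    intro h0
    -- A kernel vector is a linear form vanishing on all edges. Its two equations along `e_0` are
    -- independent, which kills the last coefficient and then the others.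
    obtain ⟨x, hx, hMx⟩ := Matrix.exists_mulVec_eq_zero_iff.2 h0
    have row : ∀ i : Fin (m + 1), ∑ l : Fin m, (w i.succ l - w 0 l) * x l.castSucc +
        (w i.succ 0 ^ 2 - w 0 0 ^ 2) * x (Fin.last m) = 0 := by
      intro i
      have := congrFun hMx i
      simpa [Matrix.mulVec, dotProduct, Fin.sum_univ_castSucc, W] using this
    have e1 : ∀ l : Fin m, 1 / 8 * x l.castSucc +
        (if l = 0 then 3 / 64 * x (Fin.last m) else 0) = 0 := by
      intro l
      have := row l.castSucc
      simp only [w1, w0] at this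
      rw [Finset.sum_eq_single l (fun b _ hb => by simp [hb]) (by simp)] at this
      by_cases hl : l = 0
      · subst hl
        simp only [if_true] at this ⊢
        linarith
      · simp only [if_true, if_neg hl, if_neg (Ne.symm hl)] at this ⊢
        linarith
    have e2 : 1 / 4 * x (Fin.castSucc (0 : Fin m)) + 1 / 8 * x (Fin.last m) = 0 := by
      have := row (Fin.last m)
      simp only [w2, w0] at this
      rw [Finset.sum_eq_single 0 (fun b _ hb => by simp [hb]) (by simp)] at this
      simp only [if_true] at this
      linarith
    have e3 := e1 0
    simp only [if_true] at e3
    have e4 : x (Fin.last m) = 0 := by linarith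
    apply hx
    funext j
    refine Fin.lastCases e4 (fun l => ?_) j
    have := e1 l
    simp only [e4, mul_zero, ite_self, add_zero] at this
    simpa using this
  have hd : 0 < |simplexDet W| / 2 := by positivity
  obtain ⟨δ, hδ, hball⟩ :=
    Metric.continuousAt_iff.1 (continuous_simplexDet.continuousAt (x := W)) _ hd
  refine ⟨w, min δ (1 / 8), |simplexDet W| / 2, by positivity, min_le_right _ _, hd, ?_, ?_⟩
  · intro i j
    refine Fin.cases ?_ (fun i => Fin.lastCases ?_ (fun l => ?_) i) i
    · rw [w0]; norm_num
    · rw [w2]; split_ifs <;> norm_num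
    · rw [w1]; split_ifs <;> norm_num
  · intro u v hu hv
    have : dist (fun i => Fin.snoc (α := fun _ => ℝ) (u i) (v i) : Fin (m + 2) → Fin (m + 1) → ℝ) W
        < δ := by
      rw [dist_pi_lt_iff hδ]
      intro i
      rw [dist_pi_lt_iff hδ]
      intro j
      refine Fin.lastCases ?_ (fun l => ?_) j
      · simpa [W, Real.dist_eq] using (hv i).trans_le (min_le_left _ _)
      · simpa [W, Real.dist_eq] using (hu i l).trans_le (min_le_left _ _)
    have h1 := hball this
    rw [Real.dist_eq] at h1
    have h2 := abs_sub_abs_le_abs_sub (simplexDet W)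
      (simplexDet fun i => Fin.snoc (α := fun _ => ℝ) (u i) (v i))
    rw [abs_sub_comm] at h2
    linarith

/-! ### From Hausdorff measure to Lebesgue measure. -/

theorem euclideanHausdorffMeasure_dropLast_image_le {m : ℕ}
    (s : Set (EuclideanSpace ℝ (Fin (m + 1)))) : volume (dropLast m '' s) ≤ μHE[m] s := by
  rw [← EuclideanSpace.euclideanHausdorffMeasure_eq_volume,
    Measure.euclideanHausdorffMeasure_def, Measure.euclideanHausdorffMeasure_def,
    Measure.smul_apply, Measure.smul_apply]
  gcongr
  simpa using lipschitzWith_dropLast.hausdorffMeasure_image_le (Nat.cast_nonneg m) s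

section Energy

variable {m : ℕ} [NeZero m] {F : ℝ → ℝ}

theorem map_graphMap_le (hF : Continuous F) {Q : Set (EuclideanSpace ℝ (Fin m))}
    {S : Set (EuclideanSpace ℝ (Fin (m + 1)))} (hQS : graphMap m F '' Q ⊆ S) :
    (volume.restrict Q).map (graphMap m F) ≤ (μHE[m]).restrict S := by
  have hG := (continuous_graphMap (m := m) hF).measurable
  refine Measure.le_intro fun s hs _ => ?_
  rw [Measure.map_apply hG hs, Measure.restrict_apply (hG hs), Measure.restrict_apply hs]
  refine le_trans (measure_mono ?_) (euclideanHausdorffMeasure_dropLast_image_le _)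
  rintro x ⟨hx, hxQ⟩
  exact ⟨graphMap m F x, ⟨hx, hQS ⟨x, hxQ, rfl⟩⟩, dropLast_graphMap x⟩

/-- Since projection does not increase Hausdorff measure, a lower bound needs no area formula. The
graph map on tuples is a measurable embedding, so measurability of the discrete curvature is not
needed either. -/
theorem setLIntegral_le_pEnergy (hF : Continuous F) (p : ℝ) {Q : Set (EuclideanSpace ℝ (Fin m))}
    {S : Set (EuclideanSpace ℝ (Fin (m + 1)))} (hQS : graphMap m F '' Q ⊆ S)
    (hQ : volume Q ≠ ∞) :
    ∫⁻ X in Set.univ.pi fun _ : Fin (m + 2) => Q,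
        discreteCurvature m (fun i => graphMap m F (X i)) ^ p ∂(Measure.pi fun _ => volume) ≤
      pEnergy m p S := by
  have hG := continuous_graphMap (m := m) hF
  have : IsFiniteMeasure ((volume : Measure (EuclideanSpace ℝ (Fin m))).restrict Q) :=
    ⟨by rw [Measure.restrict_apply_univ]; exact hQ.lt_top⟩
  have hemb : MeasurableEmbedding
      fun (X : Fin (m + 2) → EuclideanSpace ℝ (Fin m)) i => graphMap m F (X i) := by
    refine Continuous.measurableEmbedding (by fun_prop) fun X Y h => ?_
    funext i
    exact graphMap_injective (congrFun h i)
  rw [pEnergy, Measure.restrict_pi_pi, ← hemb.lintegral_map (fun T => discreteCurvature m T ^ p),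
    Measure.pi_map_pi fun _ => hG.aemeasurable]
  exact lintegral_mono' (Measure.pi_le_pi fun _ => map_graphMap_le hF hQS) le_rfl

end Energy

/-! ### Tuples at scale `1/K`. -/

/-- The box of points `x ∈ ℝ^m` such that `K x - J` is within `η` of `w`. -/
def scaledBox {m : ℕ} (K : ℝ) (η : ℝ) (w J : Fin m → ℝ) : Set (EuclideanSpace ℝ (Fin m)) :=
  {x | ∀ j, |K * x j - J j - w j| < η}

theorem isOpen_scaledBox {m : ℕ} (K η : ℝ) (w J : Fin m → ℝ) : IsOpen (scaledBox K η w J) := by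
  simp only [scaledBox, Set.ofPred_forall]
  exact isOpen_iInter_of_finite fun i => isOpen_lt (by fun_prop) continuous_const

theorem volume_scaledBox {m : ℕ} {K : ℝ} (hK : 0 < K) (η : ℝ) (w J : Fin m → ℝ) :
    volume (scaledBox K η w J) = ENNReal.ofReal (2 * η / K) ^ m := by
  have e : scaledBox K η w J = WithLp.ofLp ⁻¹' (Set.univ.pi fun j : Fin m =>
      Set.Ioo ((J j + w j - η) / K) ((J j + w j + η) / K)) := by
    ext x
    simp only [scaledBox, Set.mem_ofPred_eq, Set.mem_preimage, Set.mem_univ_pi, Set.mem_Ioo,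
      div_lt_iff₀ hK, lt_div_iff₀ hK, abs_lt]
    refine forall_congr' fun j => ?_
    constructor <;> rintro ⟨h1, h2⟩ <;> constructor <;> linarith
  rw [e, (PiLp.volume_preserving_ofLp (Fin m)).measure_preimage
    (MeasurableSet.univ_pi fun _ => measurableSet_Ioo).nullMeasurableSet, Real.volume_pi_Ioo]
  have : ∀ j : Fin m, (J j + w j + η) / K - (J j + w j - η) / K = 2 * η / K := fun j => by ring
  simp [this]

/-- The tuples of points of `ℝ^m` that, up to an error `η`, are copies of the configuration `w`
rescaled by `K⁻¹` and moved to one of the `K ^ m` cells of the unit cube. -/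
def scaledTuples {m n : ℕ} (K : ℕ) (η : ℝ) (w : Fin n → Fin m → ℝ) :
    Set (Fin n → EuclideanSpace ℝ (Fin m)) :=
  ⋃ J : Fin m → Fin K, Set.univ.pi fun i => scaledBox K η (w i) fun j => ((J j : ℕ) : ℝ)

section Tuples

variable {m n K : ℕ} {η : ℝ} {w : Fin n → Fin m → ℝ}

theorem mem_scaledTuples {X : Fin n → EuclideanSpace ℝ (Fin m)} :
    X ∈ scaledTuples K η w ↔
      ∃ J : Fin m → Fin K, ∀ i j, |(K : ℝ) * X i j - ((J j : ℕ) : ℝ) - w i j| < η := by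
  simp [scaledTuples, scaledBox]

theorem measurableSet_scaledTuples : MeasurableSet (scaledTuples K η w) :=
  MeasurableSet.iUnion fun _ => MeasurableSet.univ_pi fun _ => (isOpen_scaledBox _ _ _ _).measurableSet

theorem volume_scaledTuples [NeZero n] (hK : 0 < K) (hη : η ≤ 1 / 8)
    (hw : ∀ i j, w i j ∈ Set.Icc (1 / 8 : ℝ) (3 / 8)) :
    (Measure.pi fun _ => volume) (scaledTuples K η w) =
      (K : ℝ≥0∞) ^ m * ENNReal.ofReal (2 * η / K) ^ (m * n) := by
  have hK' : (0 : ℝ) < K := by exact_mod_cast hK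
  rw [scaledTuples, measure_iUnion]
  · simp_rw [Measure.pi_pi, volume_scaledBox hK']
    rw [tsum_fintype]
    simp [pow_mul]
  -- The bounds on `w` and `η` put `K * x_j - J_j` in `(0, 1/2)`, so the first point of a tuple
  -- already determines `J`.
  · intro J J' hJ
    rw [Function.onFun, Set.disjoint_left]
    intro X hX hX'
    apply hJ
    funext j
    have h1 := abs_lt.1 (hX 0 trivial j)
    have h2 := abs_lt.1 (hX' 0 trivial j)
    have h3 := hw 0 j
    apply Fin.ext
    have h4 : ((J j : ℕ) : ℝ) < (J' j : ℕ) + 1 := by linarith [h3.1, h3.2, h1.1, h1.2, h2.1, h2.2]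
    have h5 : ((J' j : ℕ) : ℝ) < (J j : ℕ) + 1 := by linarith [h3.1, h3.2, h1.1, h1.2, h2.1, h2.2]
    norm_cast at h4 h5
    omega
  · exact fun J => MeasurableSet.univ_pi fun _ => (isOpen_scaledBox _ _ _ _).measurableSet

theorem scaledTuples_subset (hK : 0 < K) (hη : η ≤ 1 / 8)
    (hw : ∀ i j, w i j ∈ Set.Icc (1 / 8 : ℝ) (3 / 8)) :
    scaledTuples K η w ⊆ Set.univ.pi fun _ => openCube m := by
  intro X hX i _ j
  obtain ⟨J, hJ⟩ := mem_scaledTuples.1 hX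
  have hK' : (0 : ℝ) < K := by exact_mod_cast hK
  have h1 := abs_lt.1 (hJ i j)
  have h3 := hw i j
  have h4 : ((J j : ℕ) : ℝ) + 1 ≤ K := by exact_mod_cast (J j).2
  have h5 : (0 : ℝ) ≤ (J j : ℕ) := by positivity
  constructor
  · by_contra h
    nlinarith [h3.1, h1.1, not_lt.1 h]
  · by_contra h
    nlinarith [h3.2, h1.2, not_lt.1 h]

end Tuples

/-! ### Curvature bounds and divergence of the energy. -/

theorem EuclideanSpace.dist_le_sqrt_mul {n : ℕ} {x y : EuclideanSpace ℝ (Fin n)} {b : ℝ}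
    (hb : 0 ≤ b) (h : ∀ i, |x i - y i| ≤ b) : dist x y ≤ √n * b := by
  rw [EuclideanSpace.dist_eq, ← Real.sqrt_sq hb, ← Real.sqrt_mul (by positivity)]
  refine Real.sqrt_le_sqrt ?_
  calc ∑ i, dist (x i) (y i) ^ 2 ≤ ∑ _i : Fin n, b ^ 2 := by
        refine Finset.sum_le_sum fun i _ => ?_
        rw [Real.dist_eq]
        exact pow_le_pow_left₀ (abs_nonneg _) (h i) 2
    _ = _ := by simp

/-- A lower bound for the discrete curvature in terms of the determinant of the simplex and the
diameter of its set of vertices. -/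
theorem le_discreteCurvature {m : ℕ} {T : Fin (m + 2) → EuclideanSpace ℝ (Fin (m + 1))}
    {v₀ d b : ℝ} (hv₀ : ENNReal.ofReal v₀ ≤ volume (cornerSimplex (m + 1)))
    (hd : d ≤ |simplexDet fun i j => T i j|) (hd0 : 0 ≤ d) (hb : 0 < b)
    (hT : ∀ i j, dist (T i) (T j) ≤ b) :
    ENNReal.ofReal (d * v₀ / b ^ (m + 2)) ≤ discreteCurvature m T := by
  rw [discreteCurvature, EuclideanSpace.euclideanHausdorffMeasure_eq_volume,
    volume_convexHull_range, ENNReal.ofReal_div_of_pos (by positivity),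
    ENNReal.ofReal_mul hd0, ENNReal.ofReal_pow hb.le]
  have hdiam : Metric.ediam (Set.range T) ≤ ENNReal.ofReal b := by
    refine Metric.ediam_le ?_
    rintro _ ⟨i, rfl⟩ _ ⟨j, rfl⟩
    rw [edist_dist]
    exact ENNReal.ofReal_le_ofReal (hT i j)
  gcongr

section Energy

variable {m : ℕ} [NeZero m] {N : ℕ} {α : ℝ}

theorem abs_waerdenPrimitive_sub_le_two_mul (hA : 2 ≤ (N : ℝ) ^ α) (s t : ℝ) :
    |waerdenPrimitive N α s - waerdenPrimitive N α t| ≤ 2 * |s - t| := by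
  have hA1 : 1 < (N : ℝ) ^ α := by linarith
  refine (convex_univ).norm_image_sub_le_of_norm_hasDerivWithin_le
    (fun x _ => (hasDerivAt_waerdenPrimitive hA1 x).hasDerivWithinAt) (fun x _ => ?_)
    (Set.mem_univ t) (Set.mem_univ s)
  rw [Real.norm_of_nonneg (waerden_nonneg hA1 x)]
  refine (waerden_le hA1 x).trans ?_
  rw [div_le_iff₀ (by linarith)]
  linarith

/-- The discrete curvature of the simplices inscribed in the graph of `waerdenPrimitive N α` at scale
`N^(-k)` is at least of order `N^((1-α)k)`. -/
theorem le_discreteCurvature_graphMap {w : Fin (m + 2) → Fin m → ℝ} {δ d v₀ : ℝ} (hδ0 : 0 < δ)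
    (hδ : δ ≤ 1 / 8) (hd : 0 < d) (hw : ∀ i j, w i j ∈ Set.Icc (1 / 8 : ℝ) (3 / 8))
    (hdet : ∀ (u : Fin (m + 2) → Fin m → ℝ) (v : Fin (m + 2) → ℝ), (∀ i j, |u i j - w i j| < δ) →
        (∀ i, |v i - w i 0 ^ 2| < δ) →
        d ≤ |simplexDet (fun i => Fin.snoc (α := fun _ => ℝ) (u i) (v i))|)
    (hv₀ : ENNReal.ofReal v₀ ≤ volume (cornerSimplex (m + 1)))
    (hN : 0 < N) (hA : 2 ≤ (N : ℝ) ^ α) (hB : 1 < (N : ℝ) ^ (1 - α))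
    (hε : ((N : ℝ) ^ (1 - α) - 1)⁻¹ + ((N : ℝ) ^ α - 1)⁻¹ < δ / 2) (k : ℕ)
    {X : Fin (m + 2) → EuclideanSpace ℝ (Fin m)} (hX : X ∈ scaledTuples (N ^ k) (δ / 2) w) :
    ENNReal.ofReal (d * v₀ / (√(m + 1) * 2) ^ (m + 2) * ((N : ℝ) ^ (1 - α)) ^ k) ≤
      discreteCurvature m fun i => graphMap m (waerdenPrimitive N α) (X i) := by
  set A := (N : ℝ) ^ α with hAdef
  set B := (N : ℝ) ^ (1 - α) with hBdef
  have hN' : (0 : ℝ) < N := by exact_mod_cast hN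
  have hA0 : 0 < A := by linarith
  obtain ⟨J, hJ⟩ := mem_scaledTuples.1 hX
  push_cast at hJ
  set K := (N : ℝ) ^ k with hK
  have hK0 : 0 < K := by positivity
  have hKAB : K = A ^ k * B ^ k := by rw [← mul_pow, rpow_mul_rpow_one_sub hN]
  set F := waerdenPrimitive N α with hF
  -- `u` is the position within the cell and `v` the height after the affine normalization that
  -- turns `F` into almost a parabola.
  set u : Fin (m + 2) → Fin m → ℝ := fun i j => K * X i j - (J j : ℕ) with hu
  set c := waerdenSum N α k (K⁻¹ * (J 0 : ℕ)) with hc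
  set v : Fin (m + 2) → ℝ := fun i =>
    (F (K⁻¹ * ((J 0 : ℕ) + u i 0)) - F (K⁻¹ * (J 0 : ℕ)) - K⁻¹ * c * u i 0) * (K * A ^ k) with hv
  have huw : ∀ i j, |u i j - w i j| < δ / 2 := hJ
  have hu01 : ∀ i j, 0 ≤ u i j ∧ u i j ≤ 1 / 2 := fun i j => by
    have h1 := abs_lt.1 (huw i j)
    have h2 := hw i j
    constructor <;> linarith [h2.1, h2.2, h1.1, h1.2]
  have hXu : ∀ i j, X i j = K⁻¹ * u i j + K⁻¹ * (J j : ℕ) := fun i j => by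
    simp only [hu]; field_simp; ring
  -- One `δ / 2` pays for replacing `F` by the parabola, the other for replacing `u` by `w`, as
  -- squaring is 1-Lipschitz on `[0, 1/2]`.
  have hvw : ∀ i, |v i - w i 0 ^ 2| < δ := fun i => by
    have h1 : |v i - u i 0 ^ 2| ≤ (B - 1)⁻¹ + (A - 1)⁻¹ :=
      abs_waerdenPrimitive_sub_le hN (by linarith) hB k (J 0) (hu01 i 0).1 (hu01 i 0).2
    have h2 : |u i 0 ^ 2 - w i 0 ^ 2| ≤ δ / 2 := by
      have e : u i 0 ^ 2 - w i 0 ^ 2 = (u i 0 + w i 0) * (u i 0 - w i 0) := by ring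
      have h3 := hw i 0
      have h4 := hu01 i 0
      rw [e, abs_mul, abs_of_nonneg (by linarith [h3.1, h4.1])]
      calc (u i 0 + w i 0) * |u i 0 - w i 0| ≤ 1 * |u i 0 - w i 0| := by
            gcongr; linarith [h3.2, h4.2]
        _ ≤ δ / 2 := by rw [one_mul]; exact (huw i 0).le
    linarith [abs_sub_le (v i) (u i 0 ^ 2) (w i 0 ^ 2)]
  have hT : (fun i j => graphMap m F (X i) j) = fun i => Fin.snoc (α := fun _ => ℝ)
      (fun j => K⁻¹ * u i j + K⁻¹ * (J j : ℕ))
      (K⁻¹ * c * u i 0 + (K * A ^ k)⁻¹ * v i + F (K⁻¹ * (J 0 : ℕ))) := by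
    funext i j
    refine Fin.lastCases ?_ (fun l => ?_) j
    · have e : K⁻¹ * u i 0 + K⁻¹ * (J 0 : ℕ) = K⁻¹ * ((J 0 : ℕ) + u i 0) := by ring
      rw [graphMap_last, Fin.snoc_last, hXu, e]
      simp only [hv]
      field_simp
      ring
    · rw [graphMap_castSucc, Fin.snoc_castSucc, hXu]
  have hdetT : (K⁻¹) ^ m * (K * A ^ k)⁻¹ * d ≤ |simplexDet fun i j => graphMap m F (X i) j| := by
    rw [hT, simplexDet_snoc_affine, abs_mul, abs_of_pos (by positivity)]
    gcongr
    exact hdet u v (fun i j => (huw i j).trans (by linarith)) hvw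
  have hcoord : ∀ i i' j, |X i j - X i' j| ≤ K⁻¹ := fun i i' j => by
    have e : X i j - X i' j = K⁻¹ * (u i j - u i' j) := by rw [hXu, hXu]; ring
    rw [e, abs_mul, abs_of_pos (by positivity)]
    refine mul_le_of_le_one_right (by positivity) (abs_le.2 ⟨?_, ?_⟩) <;>
      linarith [(hu01 i j).1, (hu01 i j).2, (hu01 i' j).1, (hu01 i' j).2]
  have hdist : ∀ i i', dist (graphMap m F (X i)) (graphMap m F (X i')) ≤
      √(m + 1) * (2 * K⁻¹) := fun i i' => by
    have := EuclideanSpace.dist_le_sqrt_mul (x := graphMap m F (X i)) (y := graphMap m F (X i'))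
      (b := 2 * K⁻¹) (by positivity) fun j => ?_
    · exact_mod_cast this
    · refine Fin.lastCases ?_ (fun l => ?_) j
      · rw [graphMap_last, graphMap_last]
        exact (abs_waerdenPrimitive_sub_le_two_mul hA _ _).trans (by gcongr; exact hcoord i i' 0)
      · rw [graphMap_castSucc, graphMap_castSucc]
        have : 0 < K⁻¹ := by positivity
        linarith [hcoord i i' l]
  -- The power count is `K^(-m) * (K * A^k)⁻¹ / K^(-(m+2)) = K / A^k = B^k`.
  refine le_trans (le_of_eq ?_)
    (le_discreteCurvature hv₀ hdetT (by positivity) (by positivity) hdist)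
  congr 1
  rw [← mul_assoc, mul_pow _ K⁻¹, pow_add K⁻¹]
  have hAk : (K * A ^ k)⁻¹ = K⁻¹ ^ 2 * B ^ k := by
    have : 0 < A ^ k := by positivity
    rw [hKAB]
    have hBk : 0 < B ^ k := by positivity
    field_simp
  rw [hAk]
  have : 0 < √((m : ℝ) + 1) := by positivity
  field_simp

theorem pEnergy_graphMap_eq_top {p : ℝ} (hp : (m : ℝ) * ((m : ℝ) + 1) < p)
    (hα : α = 1 - (m : ℝ) * ((m : ℝ) + 1) / p) {w : Fin (m + 2) → Fin m → ℝ} {δ d : ℝ}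
    (hδ0 : 0 < δ) (hδ : δ ≤ 1 / 8) (hd : 0 < d)
    (hw : ∀ i j, w i j ∈ Set.Icc (1 / 8 : ℝ) (3 / 8))
    (hdet : ∀ (u : Fin (m + 2) → Fin m → ℝ) (v : Fin (m + 2) → ℝ), (∀ i j, |u i j - w i j| < δ) →
        (∀ i, |v i - w i 0 ^ 2| < δ) →
        d ≤ |simplexDet (fun i => Fin.snoc (α := fun _ => ℝ) (u i) (v i))|)
    (hN : 1 < N) (hA : 2 ≤ (N : ℝ) ^ α) (hB : 1 < (N : ℝ) ^ (1 - α))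
    (hε : ((N : ℝ) ^ (1 - α) - 1)⁻¹ + ((N : ℝ) ^ α - 1)⁻¹ < δ / 2)
    {S : Set (EuclideanSpace ℝ (Fin (m + 1)))}
    (hS : graphMap m (waerdenPrimitive N α) '' openCube m ⊆ S) :
    pEnergy m p S = ∞ := by
  have hm : 0 < m := Nat.pos_of_ne_zero (NeZero.ne m)
  have hN0 : 0 < N := by omega
  have hN' : (1 : ℝ) < N := by exact_mod_cast hN
  have hp0 : 0 < p := lt_of_le_of_lt (by positivity) hp
  have hA1 : 1 < (N : ℝ) ^ α := by linarith
  have hF : Continuous (waerdenPrimitive N α) :=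
    continuous_iff_continuousAt.2 fun x => (hasDerivAt_waerdenPrimitive hA1 x).continuousAt
  obtain ⟨v₀, hv₀0, hv₀⟩ : ∃ v₀ : ℝ, 0 < v₀ ∧
      ENNReal.ofReal v₀ ≤ volume (cornerSimplex (m + 1)) := by
    obtain ⟨r, hr0, hr⟩ := ENNReal.lt_iff_exists_nnreal_btwn.1 (volume_cornerSimplex_pos (m + 1))
    exact ⟨r, by exact_mod_cast hr0, by simpa using hr.le⟩
  set κ := d * v₀ / (√(m + 1) * 2) ^ (m + 2) with hκ
  have hκ0 : 0 < κ := by positivity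
  set β := δ ^ (m * (m + 2)) with hβ
  have hβ0 : 0 < β := by positivity
  set E : Set (Fin (m + 2) → EuclideanSpace ℝ (Fin m)) := Set.univ.pi fun _ => openCube m
  set μ : Measure (Fin (m + 2) → EuclideanSpace ℝ (Fin m)) := Measure.pi fun _ => volume
  set g := fun X : Fin (m + 2) → EuclideanSpace ℝ (Fin m) =>
    discreteCurvature m (fun i => graphMap m (waerdenPrimitive N α) (X i)) ^ p
  have hvol : ∀ k, μ (scaledTuples (N ^ k) (δ / 2) w) =
      ENNReal.ofReal (β * (((N : ℝ)⁻¹) ^ (m * (m + 1))) ^ k) := by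
    intro k
    have hK : (0 : ℝ) < (N : ℝ) ^ k := by positivity
    rw [volume_scaledTuples (pow_pos hN0 k) (by linarith) hw, ← ENNReal.ofReal_natCast,
      ← ENNReal.ofReal_pow (by positivity), ← ENNReal.ofReal_pow (by positivity),
      ← ENNReal.ofReal_mul (by positivity)]
    congr 1
    push_cast
    rw [mul_div_cancel₀ δ two_ne_zero, inv_pow, inv_pow, div_pow, ← hβ,
      show m * (m + 2) = m + m * (m + 1) by ring, pow_add]
    field_simp
    ring
  have hcube : volume (openCube m) ≠ ∞ := by
    refine ((measure_mono ?_).trans_lt (isCompact_closedCube m).measure_lt_top).ne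
    exact fun x hx i => ⟨(hx i).1.le, (hx i).2.le⟩
  have hmain : ∫⁻ X in E, g X ∂μ = ∞ := by
    by_contra hfin
    have hsub : ∀ k, scaledTuples (N ^ k) (δ / 2) w ⊆ E := fun k =>
      scaledTuples_subset (pow_pos hN0 k) (by linarith) hw
    have hlow : ∀ k, ENNReal.ofReal (κ ^ p * β) ≤
        ∫⁻ X in scaledTuples (N ^ k) (δ / 2) w, g X ∂(μ.restrict E) := by
      intro k
      rw [Measure.restrict_restrict measurableSet_scaledTuples, Set.inter_eq_left.2 (hsub k)]
      have h1 : ∀ X ∈ scaledTuples (N ^ k) (δ / 2) w,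
          ENNReal.ofReal ((κ * ((N : ℝ) ^ (1 - α)) ^ k) ^ p) ≤ g X := by
        intro X hX
        rw [← ENNReal.ofReal_rpow_of_pos (by positivity)]
        exact ENNReal.rpow_le_rpow
          (le_discreteCurvature_graphMap hδ0 hδ hd hw hdet hv₀ hN0 hA hB hε k hX) hp0.le
      -- The exponent is critical: `(1 - α) * p = m * (m + 1)` makes the gain in curvature cancel
      -- the loss in measure exactly.
      have h2 : (((N : ℝ) ^ (1 - α)) ^ k) ^ p = ((N : ℝ) ^ (m * (m + 1))) ^ k := by
        rw [Real.rpow_pow_comm (by positivity), ← Real.rpow_mul (by positivity)]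
        have : (1 - α) * p = ((m * (m + 1) : ℕ) : ℝ) := by
          rw [hα]; push_cast; field_simp; ring
        rw [this, Real.rpow_natCast, pow_right_comm]
      refine le_trans (le_of_eq ?_) (setLIntegral_mono' measurableSet_scaledTuples h1)
      rw [setLIntegral_const, hvol, ← ENNReal.ofReal_mul (by positivity)]
      congr 1
      rw [Real.mul_rpow (by positivity) (by positivity), h2, inv_pow, inv_pow]
      have : (0 : ℝ) < ((N : ℝ) ^ (m * (m + 1))) ^ k := by positivity
      field_simp
    have hzero : Filter.Tendsto (μ.restrict E ∘ fun k => scaledTuples (N ^ k) (δ / 2) w)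
        Filter.atTop (nhds 0) := by
      have h0 : Filter.Tendsto (fun k : ℕ => ENNReal.ofReal
          (β * (((N : ℝ)⁻¹) ^ (m * (m + 1))) ^ k)) Filter.atTop (nhds 0) := by
        have : Filter.Tendsto (fun k : ℕ => β * (((N : ℝ)⁻¹) ^ (m * (m + 1))) ^ k)
            Filter.atTop (nhds (β * 0)) := by
          refine (tendsto_pow_atTop_nhds_zero_of_lt_one (by positivity) ?_).const_mul β
          exact pow_lt_one₀ (by positivity) (inv_lt_one_of_one_lt₀ hN') (by positivity)
        simpa using ENNReal.tendsto_ofReal this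
      refine tendsto_of_tendsto_of_tendsto_of_le_of_le tendsto_const_nhds h0 (fun _ => zero_le)
        fun k => ?_
      exact (Measure.restrict_apply_le _ _).trans_eq (hvol k)
    -- A finite integral would tend to `0` over these shrinking sets. This avoids making the scales
    -- disjoint in order to sum their contributions.
    have hlim := ge_of_tendsto' (tendsto_setLIntegral_zero hfin hzero) hlow
    exact absurd hlim (not_le.2 (ENNReal.ofReal_pos.2 (by positivity)))
  exact top_le_iff.1 (hmain.symm.le.trans (setLIntegral_le_pEnergy hF p hS hcube))

end Energy

theorem theorem6p1 (m : ℕ) [NeZero m] (p α : ℝ) (hp : (m : ℝ) * ((m : ℝ) + 1) < p)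
    (hα : α = 1 - (m : ℝ) * ((m : ℝ) + 1) / p) :
    ∃ N₀ : ℕ, ∀ N : ℕ, N₀ ≤ N →
      IsC1Holder α (waerdenPrimitive N α) Set.univ ∧
      IsCompact (graphMap m (waerdenPrimitive N α) '' closedCube m) ∧
      IsC1HolderManifoldWithCorners m α (graphMap m (waerdenPrimitive N α) '' closedCube m) ∧
      pEnergy m p (graphMap m (waerdenPrimitive N α) '' closedCube m) = ⊤ ∧
      IsC1HolderManifold m α (graphMap m (waerdenPrimitive N α) '' openCube m) ∧
      pEnergy m p (graphMap m (waerdenPrimitive N α) '' openCube m) = ⊤ := by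
  obtain ⟨w, δ, d, hδ0, hδ, hd, hw, hdet⟩ := exists_simplex_on_parabola m
  have hm : 0 < (m : ℝ) := by exact_mod_cast Nat.pos_of_ne_zero (NeZero.ne m)
  have hp0 : 0 < p := lt_of_le_of_lt (by positivity) hp
  have hα0 : 0 < α := by
    rw [hα, sub_pos, div_lt_one hp0]; exact hp
  have hα1 : 0 < 1 - α := by
    rw [hα, sub_sub_cancel]; positivity
  -- The threshold `2 + 4 / δ` gives both `A ≥ 2` and errors below `δ / 4` each, hence below `δ / 2`
  -- together.
  have hlarge : ∀ β : ℝ, 0 < β → ∀ᶠ N : ℕ in Filter.atTop, 2 + 4 / δ ≤ (N : ℝ) ^ β := fun β hβ =>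
    ((tendsto_rpow_atTop hβ).comp tendsto_natCast_atTop_atTop).eventually_ge_atTop _
  obtain ⟨N₀, hN₀⟩ := Filter.eventually_atTop.1
    (((hlarge α hα0).and (hlarge (1 - α) hα1)).and (Filter.eventually_gt_atTop 1))
  refine ⟨N₀, fun N hN => ?_⟩
  obtain ⟨⟨hA, hB⟩, hN1⟩ := hN₀ N hN
  have hδ4 : 0 < 4 / δ := by positivity
  have hinv : ∀ t : ℝ, 2 + 4 / δ ≤ t → (t - 1)⁻¹ < δ / 4 := fun t ht => by
    rw [inv_lt_comm₀ (by linarith) (by positivity), inv_div]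
    linarith
  have hε : ((N : ℝ) ^ (1 - α) - 1)⁻¹ + ((N : ℝ) ^ α - 1)⁻¹ < δ / 2 := by
    linarith [hinv _ hA, hinv _ hB]
  have hA1 : 1 < (N : ℝ) ^ α := by linarith
  have hB1 : 1 < (N : ℝ) ^ (1 - α) := by linarith
  have hF := fun t => hasDerivAt_waerdenPrimitive hA1 t
  have hf := continuous_waerden hA1
  have hFc : Continuous (waerdenPrimitive N α) :=
    continuous_iff_continuousAt.2 fun x => (hF x).continuousAt
  obtain ⟨C, hC0, hC⟩ := exists_holder_waerden hα0 hN1 hA1 hB1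
  have hG : IsC1Holder α (graphMap m (waerdenPrimitive N α)) Set.univ :=
    isC1Holder_graphMap hF hf hα0.le hC0 hC
  have hopen : IsOpen (openCube m) := isOpen_forall_coord_mem fun _ => isOpen_Ioo
  refine ⟨isC1Holder_of_hasDerivAt hF hf hC, (isCompact_closedCube m).image (continuous_graphMap hFc),
    isC1HolderManifoldWithCorners_graphMap hF hG, ?_, isC1HolderManifold_graphMap hF hG hopen, ?_⟩
  · exact pEnergy_graphMap_eq_top hp hα hδ0 hδ hd hw hdet hN1 (by linarith) hB1 hε
      (Set.image_mono fun x hx i => ⟨(hx i).1.le, (hx i).2.le⟩)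
  · exact pEnergy_graphMap_eq_top hp hα hδ0 hδ hd hw hdet hN1 (by linarith) hB1 hε le_rfl
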